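/- Let $\mathbb N=\{1,2,\dots\}$. For each countable limit ordinal $\beta$ fix a non-decreasing sequence $(\alpha_n^{\beta})_{n\in\mathbb N}$ of ordinals $<\beta$ with supremum $\beta$; the theorem holds for every such choice. For non-empty finite $A,B\subset\mathbb N$ and $n\in\mathbb N$ write $n\le A<B$ if $n\le\min A\le\max A<\min B$. For countable ordinals $\alpha$ the Schreier families $\mathrm S_\alpha$ of finite subsets of $\mathbb N$ are defined recursively by $$\mathrm S_0=\{\{n\}:n\in\mathbb N\},\qquad \mathrm S_{\alpha+1}=\Big\{\bigcup_{j=1}^nE_j:\ n\in\mathbb N,\ E_1,\dots,E_n\in\mathrm S_\alpha,\ n\le E_1<E_2<\dots<E_n\Big\},$$ $$\mathrm S_\beta=\{A:\ \exists n\in\mathbb N,\ n\le A\text{ and }A\in\mathrm S_{\alpha_n^\beta}\}\quad\text{for limit }\beta.$$ Let $\mathrm S_\alpha(\mathbb Q)=\{\sum_{i\in G}c_ie_i:\ G\in\mathrm S_\alpha,\ c_i\in\mathbb Q\}\subset c_0$, where $(e_i)$ is the unit vector basis of the real Banach space $c_0$, with the metric $d_\infty$ induced by $\|\cdot\|_\infty$.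 A metric space $X$ bi-Lipschitzly embeds into a metric space $Y$ if there are $s>0$, $D\ge1$ and $f\colon X\to Y$ with $s\,d_X(x,y)\le d_Y(f(x),f(y))\le sD\,d_X(x,y)$ for all $x,y\in X$. **Theorem A.** Let $M$ be a complete separable metric space such that $(\mathrm S_\alpha(\mathbb Q),d_\infty)$ bi-Lipschitzly embeds into $M$ for every countable ordinal $\alpha$. Then $M$ is Lipschitzly universal for the class of all separable metric spaces, i.e. every separable metric space bi-Lipschitzly embeds into $M$; in particular, $c_0$ bi-Lipschitzly embeds into $M$. -/

import Mathlib

open scoped ZeroAtInfty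

universe u v

/-- `X` bi-Lipschitzly embeds into `Y`: for some scaling factor `s > 0` and distortion `D ≥ 1`
there is a map `f : X → Y` with `s * d x y ≤ d (f x) (f y) ≤ s * D * d x y`. -/
def BiLipschitzEmbeds (X Y : Type*) [MetricSpace X] [MetricSpace Y] : Prop :=
  ∃ (s D : ℝ) (f : X → Y), 0 < s ∧ 1 ≤ D ∧
    ∀ x y : X, s * dist x y ≤ dist (f x) (f y) ∧ dist (f x) (f y) ≤ s * D * dist x y

/-- A choice, for every countable limit ordinal `β`, of a sequence of ordinals below `β` that
increases to `β`. (The values at other ordinals, and the term of index `0`, are never used.) -/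
def IsLadderSystem (a : Ordinal.{0} → ℕ → Ordinal.{0}) : Prop :=
  ∀ β : Ordinal.{0}, β < Ordinal.omega 1 → Order.IsSuccLimit β →
    Monotone (a β) ∧ (∀ n, a β n < β) ∧ ∀ γ < β, ∃ n, γ < a β n

/-- `SchreierMem a α A`: the finite set `A` belongs to the Schreier family of order `α` built with
the sequences `a β`, for limit `β`. The families consist of non-empty finite sets of positive
integers.
* order `0`: the singletons `{n}`, `n ≥ 1`;
* order `α + 1`: the unions `E₁ ∪ ⋯ ∪ Eₙ` with `n ≥ 1`, all `Eⱼ` of order `α` and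
  `n ≤ E₁ < E₂ < ⋯ < Eₙ`;
* limit order `β`: the sets `A` of order `a β n` with `n ≤ A`, for some `n ≥ 1`. -/
inductive SchreierMem (a : Ordinal.{0} → ℕ → Ordinal.{0}) : Ordinal.{0} → Finset ℕ → Prop
  | zero (n : ℕ) (hn : 1 ≤ n) : SchreierMem a 0 {n}
  | succ (α : Ordinal.{0}) (n : ℕ) (hn : 1 ≤ n) (E : Fin n → Finset ℕ)
      (hE : ∀ j, SchreierMem a α (E j))
      (hmin : ∀ j, ∀ m ∈ E j, n ≤ m)
      (hlt : ∀ i j, i < j → ∀ p ∈ E i, ∀ q ∈ E j, p < q) :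
      SchreierMem a (Order.succ α) (Finset.univ.biUnion E)
  | limit (β : Ordinal.{0}) (hβ : Order.IsSuccLimit β) (n : ℕ) (hn : 1 ≤ n) (A : Finset ℕ)
      (hmin : ∀ m ∈ A, n ≤ m) (hA : SchreierMem a (a β n) A) :
      SchreierMem a β A

/-- The Schreier family of order `α`. -/
def schreierFamily (a : Ordinal.{0} → ℕ → Ordinal.{0}) (α : Ordinal.{0}) : Set (Finset ℕ) :=
  {A | SchreierMem a α A}

/-- The set of the vectors `∑ i ∈ G, c i • e i` of `c₀` with `G ∈ 𝓖` and all `c i ∈ E`. As a subtype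
of `c₀ = C₀(ℕ, ℝ)` it carries the metric of the supremum norm. -/
def familySpace (𝓖 : Set (Finset ℕ)) (E : Set ℝ) : Set C₀(ℕ, ℝ) :=
  {x | ∃ G ∈ 𝓖, (∀ i ∈ G, x i ∈ E) ∧ ∀ i ∉ G, x i = 0}

/-- The rational-valued Schreier metric space of order `α`. -/
abbrev schreierSpaceRat (a : Ordinal.{0} → ℕ → Ordinal.{0}) (α : Ordinal.{0}) :
    Set C₀(ℕ, ℝ) :=
  familySpace (schreierFamily a α) (Set.range ((↑) : ℚ → ℝ))

open Filter Topology TopologicalSpace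

/-! ### Coordinates and distances in `c₀`. -/

section ZeroAtInfty

/-! By Aharoni's theorem (`biLipschitzEmbeds_c0`) it suffices to embed `c₀` into `M`, and this is an
ordinal-rank argument. Fix a dense sequence `x j` of rational vectors supported in `[0, j)`. Finite
lists of indices into a dense sequence of `M` code approximately bi-Lipschitz maps on initial
segments of `x`; an infinite branch of refinements converges to an embedding of `c₀`
(`exists_biLipschitz_of_chain`, `biLipschitzEmbeds_of_denseRange`). If there is none, these trees
are well founded for every constant; being countable, they have ranks bounded by one countable `θ`.

An embedding of the Schreier space of order `θ + 1` contradicts this bound. Moving the coordinates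
of the `x j` along an enumeration of a subset of a Schreier set is isometric (`dist_transplant`), so
the tree of such enumerations, of rank at least `θ + 1` (`le_of_strictAnti_on_schreier`), maps
monotonically into one of the trees over `M`. -/

theorem ZeroAtInftyContinuousMap.dist_le_iff {f g : C₀(ℕ, ℝ)} {r : ℝ} (hr : 0 ≤ r) :
    dist f g ≤ r ↔ ∀ i, |f i - g i| ≤ r := by
  rw [← ZeroAtInftyContinuousMap.dist_toBCF_eq_dist, BoundedContinuousFunction.dist_le hr]
  rfl

theorem ZeroAtInftyContinuousMap.abs_sub_le_dist (f g : C₀(ℕ, ℝ)) (i : ℕ) :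
    |f i - g i| ≤ dist f g :=
  (dist_le_iff dist_nonneg).1 le_rfl i

/-- The element of `c₀` with given coordinates tending to zero. -/
def c0OfTendsto (v : ℕ → ℝ) (hv : Tendsto v cofinite (𝓝 0)) : C₀(ℕ, ℝ) where
  toFun := v
  continuous_toFun := continuous_of_discreteTopology
  zero_at_infty' := by rwa [Filter.cocompact_eq_cofinite]

@[simp]
theorem c0OfTendsto_apply (v : ℕ → ℝ) (hv : Tendsto v cofinite (𝓝 0)) (i : ℕ) :
    c0OfTendsto v hv i = v i := rfl

theorem tendsto_cofinite_zero_of_eq_zero (v : ℕ → ℝ) (s : Finset ℕ) (hv : ∀ i ∉ s, v i = 0) :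
    Tendsto v cofinite (𝓝 0) := by
  refine tendsto_const_nhds.congr' ?_
  filter_upwards [s.finite_toSet.compl_mem_cofinite] with i hi
  exact (hv i hi).symm

theorem ZeroAtInftyContinuousMap.tendsto_cofinite (z : C₀(ℕ, ℝ)) :
    Tendsto z cofinite (𝓝 0) := by
  rw [← Filter.cocompact_eq_cofinite]
  exact z.zero_at_infty'

end ZeroAtInfty

/-! ### Composition and extension of bi-Lipschitz maps. -/

section BiLipschitz

theorem BiLipschitzEmbeds.trans {X Y Z : Type*} [MetricSpace X] [MetricSpace Y] [MetricSpace Z]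
    (h : BiLipschitzEmbeds X Y) (h' : BiLipschitzEmbeds Y Z) : BiLipschitzEmbeds X Z := by
  obtain ⟨s, D, f, hs, hD, hf⟩ := h
  obtain ⟨t, E, g, ht, hE, hg⟩ := h'
  refine ⟨t * s, E * D, g ∘ f, by positivity, one_le_mul_of_one_le_of_one_le hE hD,
    fun x y => ⟨?_, ?_⟩⟩
  · calc t * s * dist x y = t * (s * dist x y) := by ring
      _ ≤ t * dist (f x) (f y) := by gcongr; exact (hf x y).1
      _ ≤ _ := (hg _ _).1
  · calc dist (g (f x)) (g (f y)) ≤ t * E * dist (f x) (f y) := (hg _ _).2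
      _ ≤ t * E * (s * D * dist x y) := by gcongr; exact (hf x y).2
      _ = _ := by ring

/-- A bi-Lipschitz map from a dense sequence into a complete space extends. -/
theorem biLipschitzEmbeds_of_denseRange {X M : Type*} [MetricSpace X] [MetricSpace M]
    [CompleteSpace M] {x : ℕ → X} (hx : DenseRange x) (g : ℕ → M) {K : ℝ} (hK : 1 ≤ K)
    (hg : ∀ i j, K⁻¹ * dist (x i) (x j) ≤ dist (g i) (g j) ∧
      dist (g i) (g j) ≤ K * dist (x i) (x j)) : BiLipschitzEmbeds X M := by
  have hK0 : 0 < K := by linarith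
  have hseq : ∀ z : X, ∃ j : ℕ → ℕ, Tendsto (fun n => x (j n)) atTop (𝓝 z) := by
    intro z
    have : ∀ n : ℕ, ∃ j, dist z (x j) < 1 / ((n : ℝ) + 1) := fun n =>
      hx.exists_dist_lt z (by positivity)
    choose j hj using this
    refine ⟨j, tendsto_iff_dist_tendsto_zero.2 ?_⟩
    refine squeeze_zero (fun _ => dist_nonneg) (fun n => ?_) tendsto_one_div_add_atTop_nhds_zero_nat
    rw [dist_comm]
    exact (hj n).le
  choose j hj using hseq
  have hcau : ∀ z, ∃ y, Tendsto (fun n => g (j z n)) atTop (𝓝 y) := by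
    intro z
    refine cauchySeq_tendsto_of_complete ?_
    have hc := Metric.cauchySeq_iff.1 (hj z).cauchySeq
    refine Metric.cauchySeq_iff.2 fun ε hε => ?_
    obtain ⟨N, hN⟩ := hc (ε / K) (by positivity)
    refine ⟨N, fun m hm n hn => (hg _ _).2.trans_lt ?_⟩
    calc K * dist (x (j z m)) (x (j z n)) < K * (ε / K) := by gcongr; exact hN m hm n hn
      _ = ε := by field_simp
  choose f hf using hcau
  refine ⟨K⁻¹, K * K, f, by positivity, one_le_mul_of_one_le_of_one_le hK hK, fun y z => ?_⟩
  have h1 := (hj y).dist (hj z)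
  have h2 := (hf y).dist (hf z)
  rw [inv_mul_cancel_left₀ hK0.ne']
  exact ⟨le_of_tendsto_of_tendsto' (h1.const_mul _) h2 fun n => (hg _ _).1,
    le_of_tendsto_of_tendsto' h2 (h1.const_mul _) fun n => (hg _ _).2⟩

end BiLipschitz

/-! ### Aharoni's embedding into `c₀`. -/

section Aharoni

theorem exists_bump {X : Type*} [MetricSpace X] (A : Set X) {τ : ℝ} (hτ : 0 < τ) :
    ∃ f : X → ℝ, (∀ x y, |f x - f y| ≤ dist x y) ∧ (∀ x, 0 ≤ f x) ∧ (∀ x, f x ≤ τ) ∧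
      (∀ x ∈ A, f x = τ) ∧ ∀ x, (∀ a ∈ A, τ ≤ dist x a) → f x = 0 := by
  rcases A.eq_empty_or_nonempty with rfl | hA
  -- `infDist` to the empty set is `0`, so the formula used below would give the constant `τ` here.
  · exact ⟨fun _ => 0, by simp, by simp, by simp [hτ.le], by simp, by simp⟩
  refine ⟨fun x => max 0 (τ - Metric.infDist x A), fun x y => ?_, fun x => le_max_left _ _,
    fun x => max_le hτ.le (by linarith [Metric.infDist_nonneg (x := x) (s := A)]),
    fun x hx => ?_, fun x hx => ?_⟩
  · refine (abs_max_sub_max_le_max _ _ _ _).trans ?_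
    have h1 := Metric.infDist_le_infDist_add_dist (s := A) (x := x) (y := y)
    have h2 := Metric.infDist_le_infDist_add_dist (s := A) (x := y) (y := x)
    rw [dist_comm y x] at h2
    simp only [sub_self, abs_zero]
    refine max_le dist_nonneg (abs_le.2 ⟨?_, ?_⟩) <;> linarith
  · simp [Metric.infDist_zero_of_mem hx, hτ.le]
  · exact max_eq_left (by linarith [(Metric.le_infDist hA).2 fun {a} ha => hx a ha])

/-- The functions of one scale in Aharoni's embedding: a family of `1`-Lipschitz bumps of height
`τ`, vanishing near `o`, finitely many of which are non-zero at each point, separating the points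
at distance at least `5 * τ`. -/
theorem exists_bumps_of_scale {X : Type*} [MetricSpace X] [SeparableSpace X] (o : X) {τ : ℝ}
    (hτ : 0 < τ) :
    ∃ f : ℕ → X → ℝ, (∀ i x y, |f i x - f i y| ≤ dist x y) ∧ (∀ i x, 0 ≤ f i x) ∧
      (∀ i x, f i x ≤ τ) ∧ (∀ x, {i | f i x ≠ 0}.Finite) ∧
      (∀ i x, dist x o ≤ τ → f i x = 0) ∧
      ∀ x y, 5 * τ ≤ dist x y → ∃ i, τ ≤ |f i x - f i y| := by
  have : Nonempty X := ⟨o⟩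
  let a := denseSeq X
  -- Points whose first `2τ`-close dense point is `a i`. Each piece has diameter at most `4τ`, which
  -- explains the `5τ`; a point within `τ` of `a j` is at least `τ` away from every later piece.
  let A : ℕ → Set X := fun i =>
    {x | dist x (a i) < 2 * τ ∧ (∀ j < i, 2 * τ ≤ dist x (a j)) ∧ 2 * τ ≤ dist x o}
  choose f hlip h0 hle hmem hfar using fun i => exists_bump (A i) hτ
  have key : ∀ x y, 5 * τ ≤ dist x y → 2 * τ ≤ dist x o → ∃ i, τ ≤ |f i x - f i y| := by
    classical
    intro x y hxy hxo
    have hex : ∃ i, dist x (a i) < 2 * τ :=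
      (denseRange_denseSeq X).exists_dist_lt x (by positivity)
    have hxA : x ∈ A (Nat.find hex) :=
      ⟨Nat.find_spec hex, fun j hj => not_lt.1 (Nat.find_min hex hj), hxo⟩
    refine ⟨Nat.find hex, ?_⟩
    rw [hmem _ x hxA, hfar _ y, sub_zero, abs_of_pos hτ]
    intro b hb
    have h1 := hxA.1
    have h2 := hb.1
    have h3 := dist_triangle4 x (a (Nat.find hex)) b y
    rw [dist_comm b y, dist_comm _ b] at h3
    linarith
  refine ⟨f, hlip, h0, hle, fun x => ?_, fun i x hx => ?_, fun x y hxy => ?_⟩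
  · obtain ⟨j, hj⟩ := (denseRange_denseSeq X).exists_dist_lt x hτ
    refine (Set.finite_Iic j).subset fun i hi => ?_
    by_contra hij
    refine hi (hfar i x fun b hb => ?_)
    have h1 := hb.2.1 j (not_le.1 hij)
    have h2 := dist_triangle b x (a j)
    rw [dist_comm b x] at h2
    have h3 : dist x (a j) < τ := hj
    linarith
  · refine hfar i x fun b hb => ?_
    have h1 := hb.2.2
    have h2 := dist_triangle b x o
    rw [dist_comm b x] at h2
    linarith
  · rcases le_or_gt (2 * τ) (dist x o) with h | h
    · exact key x y hxy h
    · have h2 := dist_triangle x o y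
      rw [dist_comm o y] at h2
      obtain ⟨i, hi⟩ := key y x (by rwa [dist_comm]) (by linarith)
      exact ⟨i, by rwa [abs_sub_comm]⟩

/-- Aharoni's theorem: every separable metric space bi-Lipschitzly embeds into `c₀`. -/
theorem biLipschitzEmbeds_c0 (X : Type*) [MetricSpace X] [SeparableSpace X] :
    BiLipschitzEmbeds X C₀(ℕ, ℝ) := by
  rcases isEmpty_or_nonempty X with hX | ⟨⟨o⟩⟩
  · exact ⟨1, 1, fun _ => 0, one_pos, le_rfl, fun x => isEmptyElim x⟩
  choose f hlip h0 hle hfin hnear hsep using fun k : ℤ =>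
    exists_bumps_of_scale o (zpow_pos (two_pos : (0 : ℝ) < 2) k)
  have htends : ∀ x, Tendsto (fun p : ℤ × ℕ => f p.1 p.2 x) cofinite (𝓝 0) := by
    intro x
    refine Metric.tendsto_nhds.2 fun ε hε => ?_
    rw [Filter.eventually_cofinite]
    obtain ⟨k₀, hk₀⟩ := exists_mem_Ioc_zpow hε one_lt_two
    obtain ⟨k₁, hk₁⟩ := exists_nat_gt (dist x o)
    have hK : dist x o ≤ (2 : ℝ) ^ (k₁ : ℤ) := by
      rw [zpow_natCast]
      exact hk₁.le.trans (by exact_mod_cast Nat.lt_two_pow_self.le)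
    -- A value at least `ε` forces `ε ≤ 2 ^ k` by the height, and `2 ^ k < dist x o` by the
    -- vanishing near `o`.
    refine Set.Finite.subset (s := ⋃ k ∈ Set.Icc k₀ (k₁ : ℤ), Prod.mk k '' {i | f k i x ≠ 0})
      ((Set.finite_Icc _ _).biUnion fun k _ => (hfin k x).image _) ?_
    rintro ⟨k, i⟩ hki
    simp only [Set.mem_ofPred_eq, Real.dist_eq, sub_zero, not_lt, abs_of_nonneg (h0 k i x)] at hki
    have hne : f k i x ≠ 0 := by linarith
    simp only [Set.mem_iUnion]
    refine ⟨k, ⟨?_, ?_⟩, i, hne, rfl⟩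
    · have : (2 : ℝ) ^ k₀ < 2 ^ k := hk₀.1.trans_le (hki.trans (hle k i x))
      exact ((zpow_lt_zpow_iff_right₀ one_lt_two).1 this).le
    · by_contra hk
      refine hne (hnear k i x (hK.trans ?_))
      exact (zpow_le_zpow_iff_right₀ one_lt_two).2 (not_le.1 hk).le
  let e : ℕ ≃ ℤ × ℕ := (Denumerable.eqv (ℤ × ℕ)).symm
  let F : X → C₀(ℕ, ℝ) := fun x =>
    c0OfTendsto (fun n => f (e n).1 (e n).2 x) ((htends x).comp e.injective.tendsto_cofinite)
  refine ⟨1 / 10, 10, F, by norm_num, by norm_num, fun x y => ⟨?_, ?_⟩⟩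
  · rcases (dist_nonneg (x := x) (y := y)).eq_or_lt with h | h
    · rw [← h, mul_zero]
      exact dist_nonneg
    -- The scale with `2 ^ k ≤ dist x y / 5 < 2 ^ (k + 1)` separates by `2 ^ k`, more than a tenth
    -- of the distance.
    obtain ⟨k, hk, hk'⟩ := exists_mem_Ico_zpow (show 0 < dist x y / 5 by positivity) one_lt_two
    obtain ⟨i, hi⟩ := hsep k x y (by linarith)
    have h1 := ZeroAtInftyContinuousMap.abs_sub_le_dist (F x) (F y) (e.symm (k, i))
    simp only [F, c0OfTendsto_apply, Equiv.apply_symm_apply] at h1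
    rw [zpow_add_one₀ two_ne_zero] at hk'
    linarith
  · rw [ZeroAtInftyContinuousMap.dist_le_iff (by positivity)]
    intro n
    have := hlip (e n).1 (e n).2 x y
    simp only [F, c0OfTendsto_apply]
    linarith

end Aharoni

/-! ### Ranks of Schreier families. -/

section Schreier

variable {a : Ordinal.{0} → ℕ → Ordinal.{0}}

theorem schreierMem_singleton (ha : IsLadderSystem a) {α : Ordinal.{0}} (hα : α < Ordinal.omega 1)
    {m : ℕ} (hm : 1 ≤ m) : SchreierMem a α {m} := by
  induction α using WellFoundedLT.induction with
  | ind α ih =>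
    induction α using Ordinal.limitRecOn with
    | zero => exact .zero m hm
    | add_one α _ =>
      rw [← Order.succ_eq_add_one] at *
      have h := SchreierMem.succ (a := a) α 1 le_rfl (fun _ => {m})
        (fun _ => ih α (Order.lt_succ α) ((Order.lt_succ α).trans hα)) (by simpa using hm)
        (fun i j hij => by omega)
      simpa using h
    | limit α hlim _ =>
      have h := (ha α hα hlim).2.1 1
      exact .limit α hlim 1 le_rfl {m} (by simpa using hm) (ih _ h (h.trans hα))

theorem SchreierMem.insert (ha : IsLadderSystem a) {α : Ordinal.{0}} (hα : α < Ordinal.omega 1)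
    {m : ℕ} (hm : 2 ≤ m) {G : Finset ℕ} (hG : SchreierMem a α G) (hmG : ∀ x ∈ G, m < x) :
    SchreierMem a (Order.succ α) (insert m G) := by
  have h := SchreierMem.succ (a := a) α 2 one_le_two ![{m}, G]
    (by simp [Fin.forall_fin_two, hG, schreierMem_singleton ha hα (one_le_two.trans hm)])
    (by
      simp only [Fin.forall_fin_two]
      exact ⟨by simpa using hm, fun x hx => hm.trans (hmG x hx).le⟩)
    (by
      simp only [Fin.forall_fin_two]
      simpa using hmG)
  convert h using 1
  ext x
  simp [Fin.exists_fin_two]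

/-- The tree of the (enumerations of subsets of) members of the Schreier family of order `α` has
rank at least `α`. -/
theorem le_of_strictAnti_on_schreier (ha : IsLadderSystem a) {α : Ordinal.{0}}
    (hα : α < Ordinal.omega 1) (N : ℕ) (ρ : List ℕ → Ordinal.{0})
    (hρ : ∀ l m G, SchreierMem a α G → (∀ x ∈ G, N ≤ x) → (l ++ [m]).Nodup →
      (∀ x ∈ l ++ [m], x ∈ G) → ρ (l ++ [m]) < ρ l) : α ≤ ρ [] := by
  induction α using WellFoundedLT.induction generalizing N ρ with
  | ind α ih =>
    induction α using Ordinal.limitRecOn with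
    | zero => exact zero_le
    | add_one α _ =>
      rw [← Order.succ_eq_add_one] at *
      have hα' := (Order.lt_succ α).trans hα
      -- The first entry `n` of the branch must be at least `2`, so that `{n} ∪ G` is an admissible
      -- union of two sets. The subtree above `[n]` then contains the tree of order `α` beyond `n`.
      set n := max N 2 with hn
      have hn2 : 2 ≤ n := le_max_right _ _
      have hnN : N ≤ n := le_max_left _ _
      have h1 : α ≤ ρ [n] := by
        refine ih α (Order.lt_succ α) hα' (n + 1) (fun l => ρ (n :: l)) ?_
        intro l m G hG hGn hnodup hsub
        have hmG : ∀ x ∈ G, n < x := fun x hx => hGn x hx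
        refine hρ (n :: l) m (insert n G) (hG.insert ha hα' hn2 hmG) ?_ ?_ ?_
        · intro x hx
          rcases Finset.mem_insert.1 hx with rfl | hx
          · exact hnN
          · exact hnN.trans (hmG x hx).le
        · rw [List.cons_append, List.nodup_cons]
          exact ⟨fun h => (hmG n (hsub n h)).false, hnodup⟩
        · intro x hx
          rw [List.cons_append, List.mem_cons] at hx
          exact Finset.mem_insert.2 (hx.imp id (hsub x))
      refine Order.succ_le_of_lt (h1.trans_lt ?_)
      exact hρ [] n {n} (schreierMem_singleton ha hα (one_le_two.trans hn2)) (by simpa using hnN)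
        (by simp) (by simp)
    | limit α hlim _ =>
      obtain ⟨hmono, hlt, hsup⟩ := ha α hα hlim
      refine le_of_forall_lt fun γ hγ => ?_
      obtain ⟨n, hn⟩ := hsup γ hγ
      -- Index `0` is not admissible at limit stages, hence the shift.
      have hn' : γ < a α (n + 1) := hn.trans_le (hmono n.le_succ)
      refine hn'.trans_le (ih _ (hlt _) ((hlt _).trans hα) (max N (n + 1)) ρ ?_)
      intro l m G hG hGn hnodup hsub
      exact hρ l m G (.limit α hlim (n + 1) (by omega) G
        (fun x hx => (le_max_right _ _).trans (hGn x hx)) hG)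
        (fun x hx => (le_max_left _ _).trans (hGn x hx)) hnodup hsub

end Schreier

/-! ### Trees of approximate partial embeddings. -/

section Tree

theorem IsWellFounded.rank_lt_omega_one {T : Type} [Countable T] (r : T → T → Prop)
    [IsWellFounded T r] (t : T) : IsWellFounded.rank r t < Ordinal.omega 1 := by
  induction t using IsWellFounded.induction r with
  | ind t ih =>
    rw [IsWellFounded.rank_eq]
    refine Ordinal.iSup_lt_omega_one fun b => ?_
    exact (Cardinal.isSuccLimit_omega 1).succ_lt (ih b b.2)

variable {X M : Type*} [MetricSpace X] [MetricSpace M]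

/-- A finite list `p` codes a partial map `x j ↦ d (p j)`, `j < p.length`. The list `q` refines `p`
if it codes one more value, if its values are close to those of `p`, and if the map that it codes is
bi-Lipschitz with constant `K` up to a small additive error. -/
def Refines (x : ℕ → X) (d : ℕ → M) (K : ℝ) (q p : List ℕ) : Prop :=
  q.length = p.length + 1 ∧
  (∀ j < p.length, dist (d (p.getD j 0)) (d (q.getD j 0)) ≤ 2 * (1 / 2) ^ p.length) ∧
  ∀ i < q.length, ∀ j < q.length,
    K⁻¹ * dist (x i) (x j) - 2 * (1 / 2) ^ q.length ≤ dist (d (q.getD i 0)) (d (q.getD j 0)) ∧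
    dist (d (q.getD i 0)) (d (q.getD j 0)) ≤ K * dist (x i) (x j) + 2 * (1 / 2) ^ q.length

/-- Successive changes of a fixed value are geometrically small, so the values converge; the
additive errors vanish in the limit. -/
theorem exists_biLipschitz_of_chain [CompleteSpace M] {x : ℕ → X} {d : ℕ → M} {K : ℝ}
    {p : ℕ → List ℕ} (hp : ∀ n, Refines x d K (p (n + 1)) (p n)) :
    ∃ g : ℕ → M, ∀ i j, K⁻¹ * dist (x i) (x j) ≤ dist (g i) (g j) ∧
      dist (g i) (g j) ≤ K * dist (x i) (x j) := by
  have hlen : ∀ n, (p n).length = (p 0).length + n := by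
    intro n
    induction n with
    | zero => rfl
    | succ n ih => rw [(hp n).1, ih]; ring
  have hpow : ∀ n, (1 / 2 : ℝ) ^ (p n).length ≤ (1 / 2) ^ n := fun n =>
    pow_le_pow_of_le_one (by norm_num) (by norm_num) (by rw [hlen]; omega)
  have hlim : ∀ j, ∃ y, Tendsto (fun n => d ((p n).getD j 0)) atTop (𝓝 y) := by
    intro j
    -- After `j + 1` steps the lists are longer than `j`, and the default of `getD` no longer
    -- intervenes.
    have hc : CauchySeq fun n => d ((p (n + (j + 1))).getD j 0) := by
      refine cauchySeq_of_le_geometric (1 / 2) 2 (by norm_num) fun n => ?_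
      have h1 := (hp (n + (j + 1))).2.1 j (by rw [hlen]; omega)
      rw [show n + 1 + (j + 1) = n + (j + 1) + 1 by ring]
      refine h1.trans ?_
      gcongr 2 * ?_
      exact (hpow _).trans (pow_le_pow_of_le_one (by norm_num) (by norm_num) (by omega))
    obtain ⟨y, hy⟩ := cauchySeq_tendsto_of_complete hc
    exact ⟨y, (tendsto_add_atTop_iff_nat (j + 1)).1 hy⟩
  choose g hg using hlim
  refine ⟨g, fun i j => ?_⟩
  have hd := ((hg i).dist (hg j)).comp (tendsto_add_atTop_nat 1)
  have herr : Tendsto (fun n => 2 * (1 / 2 : ℝ) ^ (p (n + 1)).length) atTop (𝓝 0) := by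
    have h : Tendsto (fun n : ℕ => (1 / 2 : ℝ) ^ (p n).length) atTop (𝓝 0) :=
      squeeze_zero (fun _ => by positivity) hpow
        (tendsto_pow_atTop_nhds_zero_of_lt_one (by norm_num) (by norm_num))
    simpa using (h.comp (tendsto_add_atTop_nat 1)).const_mul 2
  have hev : ∀ᶠ n in atTop, i < (p (n + 1)).length ∧ j < (p (n + 1)).length := by
    filter_upwards [eventually_ge_atTop (max i j)] with n hn
    rw [hlen]
    constructor <;> omega
  constructor
  · have h1 := (tendsto_const_nhds (x := K⁻¹ * dist (x i) (x j))).sub herr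
    rw [sub_zero] at h1
    refine le_of_tendsto_of_tendsto h1 hd ?_
    filter_upwards [hev] with n hn
    exact ((hp n).2.2 i hn.1 j hn.2).1
  · have h1 := (tendsto_const_nhds (x := K * dist (x i) (x j))).add herr
    rw [add_zero] at h1
    refine le_of_tendsto_of_tendsto hd h1 ?_
    filter_upwards [hev] with n hn
    exact ((hp n).2.2 i hn.1 j hn.2).2

end Tree

/-! ### Embedding `c₀` into `M`. -/

section Universal

theorem exists_dense_rational_seq :
    ∃ w : ℕ → ℕ → ℚ, (∀ j i, j ≤ i → w j i = 0) ∧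
      ∀ (z : C₀(ℕ, ℝ)) (ε : ℝ), 0 < ε → ∃ j, ∀ i, |z i - w j i| ≤ ε := by
  obtain ⟨e, he⟩ := exists_surjective_nat (ℕ →₀ ℚ)
  refine ⟨fun j i => if i < j then e j.unpair.1 i else 0, fun j i h => if_neg h.not_gt,
    fun z ε hε => ?_⟩
  have hfin : {i | ¬ |z i| < ε}.Finite := by
    have := Metric.tendsto_nhds.1 z.tendsto_cofinite ε hε
    simpa [Filter.eventually_cofinite] using this
  have hq : ∀ i, ∃ q : ℚ, |z i - q| < ε := fun i => by
    obtain ⟨q, hq⟩ := (Rat.isDenseEmbedding_coe_real.dense).exists_dist_lt (z i) hε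
    exact ⟨q, hq⟩
  choose q hq using hq
  classical
  let v : ℕ →₀ ℚ := Finsupp.onFinset hfin.toFinset
    (fun i => if i ∈ hfin.toFinset then q i else 0) (fun i hi => by
      by_contra h
      exact hi (if_neg h))
  obtain ⟨k, hk⟩ := he v
  obtain ⟨n, hn⟩ := v.support.exists_nat_subset_range
  -- Since `n ≤ Nat.pair k n`, truncating at the index keeps the whole support of `v`.
  refine ⟨Nat.pair k n, fun i => ?_⟩
  have hw : (if i < Nat.pair k n then e (Nat.pair k n).unpair.1 i else 0) = v i := by
    rw [Nat.unpair_pair, hk]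
    split_ifs with h
    · rfl
    · symm
      by_contra hv
      have := Finset.mem_range.1 (hn (Finsupp.mem_support_iff.2 hv))
      exact h (this.trans_le (Nat.right_le_pair k n))
  beta_reduce
  rw [hw]
  by_cases h : i ∈ hfin.toFinset
  · have : v i = q i := if_pos h
    rw [this]
    exact (hq i).le
  · have h0 : v i = 0 := if_neg h
    rw [h0, Rat.cast_zero, sub_zero]
    rw [Set.Finite.mem_toFinset, Set.mem_ofPred_eq, not_not] at h
    exact h.le

/-- The vector obtained by moving the `i`-th coordinate of `w` to the `i`-th entry of `l`. -/
def transplant (w : ℕ → ℚ) (l : List ℕ) : C₀(ℕ, ℝ) :=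
  c0OfTendsto (fun p => if p ∈ l then (w (l.idxOf p) : ℝ) else 0)
    (tendsto_cofinite_zero_of_eq_zero _ l.toFinset fun _ hp =>
      if_neg fun h => hp (List.mem_toFinset.2 h))

theorem transplant_mem_familySpace (w : ℕ → ℚ) {l : List ℕ} {𝓖 : Set (Finset ℕ)} {G : Finset ℕ}
    (hG : G ∈ 𝓖) (hl : ∀ p ∈ l, p ∈ G) :
    transplant w l ∈ familySpace 𝓖 (Set.range ((↑) : ℚ → ℝ)) := by
  refine ⟨G, hG, fun p _ => ?_, fun p hp => if_neg fun h => hp (hl p h)⟩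
  by_cases h : p ∈ l
  · exact ⟨w (l.idxOf p), (if_pos h).symm⟩
  · exact ⟨0, by rw [Rat.cast_zero]; exact (if_neg h).symm⟩

theorem transplant_apply {w : ℕ → ℚ} {l : List ℕ} (hw : ∀ i, l.length ≤ i → w i = 0) (p : ℕ) :
    transplant w l p = w (l.idxOf p) := by
  by_cases h : p ∈ l
  · exact if_pos h
  · rw [List.idxOf_eq_length h, hw _ le_rfl, Rat.cast_zero]
    exact if_neg h

/-- Extending a branch leaves the vectors already placed unchanged, so the coded values move only by
approximation errors. -/
theorem transplant_append {w : ℕ → ℚ} {l : List ℕ} (hw : ∀ i, l.length ≤ i → w i = 0) (m : ℕ) :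
    transplant w (l ++ [m]) = transplant w l := by
  ext p
  rw [transplant_apply hw, transplant_apply fun i hi => hw i (le_trans (by simp) hi)]
  by_cases h : p ∈ l
  · rw [List.idxOf_append_of_mem h]
  · rw [List.idxOf_append_of_notMem h, hw _ (Nat.le_add_right _ _), List.idxOf_eq_length h,
      hw _ le_rfl]

theorem dist_transplant {w w' : ℕ → ℚ} {l : List ℕ} (hl : l.Nodup)
    (hw : ∀ i, l.length ≤ i → w i = 0) (hw' : ∀ i, l.length ≤ i → w' i = 0) {z z' : C₀(ℕ, ℝ)}
    (hz : ∀ i, z i = w i) (hz' : ∀ i, z' i = w' i) :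
    dist (transplant w l) (transplant w' l) = dist z z' := by
  refine le_antisymm ((ZeroAtInftyContinuousMap.dist_le_iff dist_nonneg).2 fun p => ?_)
    ((ZeroAtInftyContinuousMap.dist_le_iff dist_nonneg).2 fun i => ?_)
  · rw [transplant_apply hw, transplant_apply hw', ← hz, ← hz']
    exact ZeroAtInftyContinuousMap.abs_sub_le_dist z z' _
  · rcases lt_or_ge i l.length with hi | hi
    · have h := ZeroAtInftyContinuousMap.abs_sub_le_dist (transplant w l) (transplant w' l) l[i]
      rwa [transplant_apply hw, transplant_apply hw', hl.idxOf_getElem, ← hz, ← hz'] at h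
    · rw [hz, hz', hw i hi, hw' i hi]
      simp

theorem c0_biLipschitzEmbeds_of_schreier {a : Ordinal.{0} → ℕ → Ordinal.{0}}
    (ha : IsLadderSystem a) (M : Type*) [MetricSpace M] [CompleteSpace M] [SeparableSpace M]
    (hM : ∀ α : Ordinal.{0}, α < Ordinal.omega 1 → BiLipschitzEmbeds (schreierSpaceRat a α) M) :
    BiLipschitzEmbeds C₀(ℕ, ℝ) M := by
  classical
  by_contra hno
  have hne : Nonempty M := by
    obtain ⟨_, _, f, -⟩ := hM 0 (Ordinal.omega_pos 1)
    exact ⟨f ⟨_, transplant_mem_familySpace 0 (SchreierMem.zero 1 le_rfl) (l := []) (by simp)⟩⟩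
  obtain ⟨w, hw0, hwd⟩ := exists_dense_rational_seq
  let x : ℕ → C₀(ℕ, ℝ) := fun j => c0OfTendsto (fun i => (w j i : ℝ))
    (tendsto_cofinite_zero_of_eq_zero _ (Finset.range j) fun i hi => by
      rw [hw0 j i (by simpa using hi), Rat.cast_zero])
  have hx : DenseRange x := by
    refine Metric.dense_iff.2 fun z ε hε => ?_
    obtain ⟨j, hj⟩ := hwd z (ε / 2) (by positivity)
    refine ⟨x j, ?_, j, rfl⟩
    rw [Metric.mem_ball']
    exact ((ZeroAtInftyContinuousMap.dist_le_iff (by positivity)).2 hj).trans_lt (by linarith)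
  let d := denseSeq M
  -- Countably many constants suffice; adding `1` keeps them at least `1`.
  let R : ℕ → List ℕ → List ℕ → Prop := fun K => Refines x d ((K : ℝ) + 1)
  have hwf : ∀ K, IsWellFounded (List ℕ) (R K) := by
    intro K
    refine ⟨wellFounded_iff_isEmpty_descending_chain.2 ⟨fun ⟨p, hp⟩ => hno ?_⟩⟩
    obtain ⟨g, hg⟩ := exists_biLipschitz_of_chain hp
    exact biLipschitzEmbeds_of_denseRange hx g (by simp) hg
  let θ : Ordinal.{0} := ⨆ p : ℕ × List ℕ, IsWellFounded.rank (R p.1) p.2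
  have hθ : θ < Ordinal.omega 1 :=
    Ordinal.iSup_lt_omega_one fun p => IsWellFounded.rank_lt_omega_one (R p.1) p.2
  have hα : Order.succ θ < Ordinal.omega 1 := (Cardinal.isSuccLimit_omega 1).succ_lt hθ
  obtain ⟨s, D, f, hs, hD, hf⟩ := hM _ hα
  obtain ⟨K, hK⟩ := exists_nat_gt (max s⁻¹ (s * D))
  have hKs : ((K : ℝ) + 1)⁻¹ ≤ s :=
    inv_le_of_inv_le₀ hs (by linarith [le_max_left s⁻¹ (s * D)])
  have hKD : s * D ≤ (K : ℝ) + 1 := by linarith [le_max_right s⁻¹ (s * D)]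
  let F : C₀(ℕ, ℝ) → M := fun z =>
    if h : z ∈ schreierSpaceRat a (Order.succ θ) then f ⟨z, h⟩ else Classical.arbitrary M
  have hF : ∀ z ∈ schreierSpaceRat a (Order.succ θ), ∀ z' ∈ schreierSpaceRat a (Order.succ θ),
      s * dist z z' ≤ dist (F z) (F z') ∧ dist (F z) (F z') ≤ s * D * dist z z' := by
    intro z hz z' hz'
    simp only [F, dif_pos hz, dif_pos hz']
    exact hf ⟨z, hz⟩ ⟨z', hz'⟩
  have happrox : ∀ (y : M) (n : ℕ), ∃ k, dist y (d k) < (1 / 2) ^ n := fun y n =>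
    (denseRange_denseSeq M).exists_dist_lt y (by positivity)
  choose A hA using happrox
  -- Each value is coded within `2⁻ⁿ`, `n = l.length`. Two such errors give the additive `2 * 2⁻ⁿ`
  -- in `Refines`.
  let node : List ℕ → List ℕ := fun l =>
    (List.range l.length).map fun j => A (F (transplant (w j) l)) l.length
  have hlen : ∀ l, (node l).length = l.length := fun l => by simp [node]
  have hnode : ∀ l, ∀ j < l.length,
      dist (F (transplant (w j) l)) (d ((node l).getD j 0)) < (1 / 2) ^ l.length := by
    intro l j hj
    have : (node l).getD j 0 = A (F (transplant (w j) l)) l.length := by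
      simp [node, List.getD_eq_getElem?_getD, hj]
    rw [this]
    exact hA _ _
  have hle : Order.succ θ ≤ IsWellFounded.rank (R K) (node []) := by
    refine le_of_strictAnti_on_schreier ha hα 0 (fun l => IsWellFounded.rank (R K) (node l)) ?_
    intro l m G hG _ hnodup hsub
    refine IsWellFounded.rank_lt_of_rel ⟨by simp [hlen], ?_, ?_⟩
    · intro j hj
      rw [hlen] at hj ⊢
      have h1 := hnode l j hj
      have h2 := hnode (l ++ [m]) j (by rw [List.length_append]; omega)
      rw [transplant_append fun i hi => hw0 j i (hj.le.trans hi), List.length_append,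
        List.length_singleton, pow_succ] at h2
      have h3 := dist_triangle_left (d ((node l).getD j 0)) (d ((node (l ++ [m])).getD j 0))
        (F (transplant (w j) l))
      have h4 : (0 : ℝ) < (1 / 2) ^ l.length := by positivity
      linarith
    · intro i hi j hj
      rw [hlen] at hi hj ⊢
      have h1 := hnode _ i hi
      have h2 := hnode _ j hj
      have hmem : ∀ j, transplant (w j) (l ++ [m]) ∈ schreierSpaceRat a (Order.succ θ) := fun j =>
        transplant_mem_familySpace (w j) hG hsub
      have h3 := hF _ (hmem i) _ (hmem j)
      rw [dist_transplant hnodup (fun k hk => hw0 i k (hi.le.trans hk))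
        (fun k hk => hw0 j k (hj.le.trans hk)) (z := x i) (z' := x j) (fun _ => rfl)
        (fun _ => rfl)] at h3
      have h4 := dist_triangle4_left (F (transplant (w i) (l ++ [m])))
        (F (transplant (w j) (l ++ [m]))) (d ((node (l ++ [m])).getD i 0))
        (d ((node (l ++ [m])).getD j 0))
      have h5 := dist_triangle4_right (F (transplant (w i) (l ++ [m])))
        (F (transplant (w j) (l ++ [m]))) (d ((node (l ++ [m])).getD i 0))
        (d ((node (l ++ [m])).getD j 0))
      have h6 : ((K : ℝ) + 1)⁻¹ * dist (x i) (x j) ≤ s * dist (x i) (x j) := by gcongr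
      have h7 : s * D * dist (x i) (x j) ≤ ((K : ℝ) + 1) * dist (x i) (x j) := by gcongr
      constructor <;> linarith
  have hge : IsWellFounded.rank (R K) (node []) ≤ θ :=
    Ordinal.le_iSup (fun p : ℕ × List ℕ => IsWellFounded.rank (R p.1) p.2) (K, node [])
  exact (Order.lt_succ θ).not_ge (hle.trans hge)

end Universal

theorem theoremA (a : Ordinal.{0} → ℕ → Ordinal.{0}) (ha : IsLadderSystem a)
    (M : Type u) [MetricSpace M] [CompleteSpace M] [TopologicalSpace.SeparableSpace M]
    (hM : ∀ α : Ordinal.{0}, α < Ordinal.omega 1 → BiLipschitzEmbeds (schreierSpaceRat a α) M) :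
    (∀ (X : Type v) [MetricSpace X] [TopologicalSpace.SeparableSpace X], BiLipschitzEmbeds X M) ∧
      BiLipschitzEmbeds C₀(ℕ, ℝ) M := by
  have h := c0_biLipschitzEmbeds_of_schreier ha M hM
  exact ⟨fun X _ _ => (biLipschitzEmbeds_c0 X).trans h, h⟩
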